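/- Let $(a_n)_{n\ge 0}$ be a sequence of positive real numbers and $(b_n)_{n\ge 0}$ a sequence of real numbers. A generalised eigenvector associated with $x\in\mathbb{R}$ is a real sequence $u=(u_n)_{n\ge 0}$ such that $a_{n-1}u_{n-1}+b_nu_n+a_nu_{n+1}=xu_n$ for all $n\ge 1$. For a positive integer $N$ and a real sequence $(x_n)_{n\ge m}$ put $\mathcal V_N(x_n : n\ge m)=\sum_{n=m}^{\infty}|x_{n+N}-x_n|\in[0,\infty]$. Let $N$ be a positive integer and let $(r_n)_{n\ge0}$ and $(q_n)_{n\ge0}$ be $N$-periodic real sequences such that, with $B_i=\begin{pmatrix}0&1\\-r_i&-q_i\end{pmatrix}$, $$B_{N-1}B_{N-2}\cdots B_0=\gamma\,\mathrm{Id},\qquad \gamma\in\{-1,1\}.$$ Assume $$\mathcal V_N\Big(\frac1{a_n}: n\ge0\Big)+\mathcal V_N(r_na_n-a_{n-1}: n\ge1)+\mathcal V_N(b_n-q_na_n: n\ge0)<\infty,$$ and that, for some $N$-periodic real sequences $s$ and $z$, $$\lim_{n\to\infty}a_n=\infty,\qquad \lim_{n\to\infty}|r_na_n-a_{n-1}-s_n|=0,\qquad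 \lim_{n\to\infty}|b_n-q_na_n-z_n|=0.$$ For $0\le j\le N-1$ put $\alpha_j=\prod_{k=j+1}^{N-1}r_k$, and for $x\in\mathbb{R}$ put $$\mathcal C(x)=\sum_{j=0}^{N-1}\frac1{\alpha_j}\,(B_{N-1}\cdots B_{j+1})\begin{pmatrix}0&0\\ s_j&x-z_j\end{pmatrix}(B_{j-1}\cdots B_0),$$ $$I(s,z)=\{x\in\mathbb{R}: (\operatorname{tr}\mathcal C(x))^2-4\det\mathcal C(x)\ge0\},$$ where an empty product of matrices is the identity. Then $I(s,z)$ is a non-empty compact interval (possibly a single point), and for every compact set $K\subset\Lambda:=\mathbb{R}\setminus I(s,z)$ there are constants $c_1,c_2>0$ such that for every generalised eigenvector $u$ associated with some $x\in K$ and every $n\ge1$ $$c_1(u_0^2+u_1^2)\le a_n(u_{n-1}^2+u_n^2)\le c_2(u_0^2+u_1^2).$$ -/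

import Mathlib

open Filter Topology
open scoped ENNReal Matrix

namespace Jacobi

/-- Total `N`-variation of `(x n : n ≥ m)`, that is `∑_{n ≥ m} |x (n + N) - x n|`, as an element
of `[0, ∞]`. -/
noncomputable def totalVariation (N m : ℕ) (x : ℕ → ℝ) : ℝ≥0∞ :=
  ∑' n : ℕ, ENNReal.ofReal |x (m + n + N) - x (m + n)|

/-- `u` is a generalised eigenvector associated with `x`:
`a (n-1) * u (n-1) + b n * u n + a n * u (n+1) = x * u n` for all `n ≥ 1`. -/
def IsGeneralizedEigenvector (a b : ℕ → ℝ) (x : ℝ) (u : ℕ → ℝ) : Prop :=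
  ∀ n : ℕ, 1 ≤ n → a (n - 1) * u (n - 1) + b n * u n + a n * u (n + 1) = x * u n

/-- Ordered product of `k` consecutive matrices starting at index `i`, later indices on the left:
`C (i + k - 1) * ⋯ * C (i + 1) * C i` (the identity for `k = 0`). -/
def orderedProd (C : ℕ → Matrix (Fin 2) (Fin 2) ℝ) (i : ℕ) : ℕ → Matrix (Fin 2) (Fin 2) ℝ
  | 0 => 1
  | k + 1 => C (i + k) * orderedProd C i k

/-- The matrix `(0, 1; -r_i, -q_i)`. -/
def stepMatrix (r q : ℕ → ℝ) (i : ℕ) : Matrix (Fin 2) (Fin 2) ℝ :=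
  !![0, 1; -r i, -q i]

/-- The modulating weights `α_j = r_{j+1} r_{j+2} ⋯ r_{N-1}` (`0 ≤ j ≤ N - 1`, `α_{N-1} = 1`),
for which `r_j = α_{j-1} / α_j`. -/
noncomputable def weight (N : ℕ) (r : ℕ → ℝ) (j : ℕ) : ℝ :=
  ∏ k ∈ Finset.Ico (j + 1) N, r k

/-- The matrix
`∑_{j < N} α_j⁻¹ (B_{N-1} ⋯ B_{j+1}) (0, 0; s_j, x - z_j) (B_{j-1} ⋯ B_0)`, `B_i = (0, 1; -r_i, -q_i)`.
Its part that is linear in `x` is `x` times the derivative at `0` of the `N`-step transfer matrix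
of the periodic recurrence with coefficients `α_i` and `β_i = α_i q_i`; its constant part is the
contribution of `s` and `z`. -/
noncomputable def limitMatrix (N : ℕ) (r q s z : ℕ → ℝ) (x : ℝ) : Matrix (Fin 2) (Fin 2) ℝ :=
  ∑ j ∈ Finset.range N, (weight N r j)⁻¹ •
    (orderedProd (stepMatrix r q) (j + 1) (N - 1 - j) * !![0, 0; s j, x - z j] *
      orderedProd (stepMatrix r q) 0 j)

/-- The exceptional set `I(s, z)`: the real `x` at which the discriminant
`(tr C)^2 - 4 det C` of `C = limitMatrix N r q s z x` is nonnegative. -/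
def exceptionalSet (N : ℕ) (r q s z : ℕ → ℝ) : Set ℝ :=
  {x : ℝ | 0 ≤ (limitMatrix N r q s z x).trace ^ 2 - 4 * (limitMatrix N r q s z x).det}

end Jacobi

/-!
Write `v_n = (u_{n-1}, u_n)` and let `X_k(x)` be the `N`-step transfer matrix taking `v_{kN}` to
`v_{(k+1)N}`. The hypothesis on `B_{N-1} ⋯ B_0` says that `X_k → γ`, and after rescaling by
`A_k = a_{kN+N-1}` the remainders `R_k = A_k (X_k - γ)` converge to `limitMatrix`; telescoping the
product writes `R_k` as a polynomial in quantities of bounded variation, so the differences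
`R_{k+1} - R_k` are summable uniformly for `x` in a compact set
(`IsPeriodicPerturbation.blockRemainder`).

The asymptotics come from the Turán form `turanForm M v = det (M v, v)`. It kills multiples of the
identity, so `X_k` and `R_k / A_k` have the same form, and it satisfies
`turanForm X (X v) = det X * turanForm X v` with `det X_k = A_{k-1} / A_k`. Hence
`T_k = A_{k-1} turanForm R_k v_{kN}` obeys
`T_{k+1} - T_k = A_k turanForm (R_{k+1} - R_k) v_{(k+1)N}` (`turan_step`). The discriminant of the
form of `M` is `(tr M)² - 4 det M`, so for `x` in a compact set off the exceptional set the form of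
`R_k` is eventually uniformly definite. Then `|T_k|` is comparable to `A_{k-1} |v_{kN}|²`, its
relative increments are summable, and it stays comparable to a fixed term
(`exists_comparable_block`). Uniformly bounded and boundedly invertible one-step transfer matrices
carry this over to all indices (`comparable_of_comparable_mul`, `comparable_succ`).

For the shape of the exceptional set, the coefficient of `x` in `limitMatrix` has Turán form
`-γ ∑_j ((B_{j-1} ⋯ B_0 v) 1)²` (`turanForm_limitSlope`), which is definite. So the discriminant is
a quadratic polynomial in `x` with negative leading coefficient, and it is nonnegative at any `x` for
which the form has a nontrivial zero, which happens for some `x` since the form at a fixed nonzero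
vector is a nonconstant affine function of `x` (`disc_pencil_nonneg_eq_Icc`).
-/

namespace Jacobi

/-! ### Convergence with uniformly summable variation -/

/-- The functions `f k` converge pointwise on `K` to `L`, they are uniformly bounded on `K`, and
their consecutive differences are bounded on `K` by a summable sequence that does not depend on the
point. The last condition makes the convergence uniform on `K`. -/
structure ConvBV {X : Type*} (K : Set X) (f : ℕ → X → ℝ) (L : X → ℝ) : Prop where
  tendsto : ∀ x ∈ K, Tendsto (fun k => f k x) atTop (𝓝 (L x))
  bounded : ∃ M, 0 ≤ M ∧ ∀ k, ∀ x ∈ K, |f k x| ≤ M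
  variation : ∃ ε : ℕ → ℝ, Summable ε ∧ ∀ k, ∀ x ∈ K, |f (k + 1) x - f k x| ≤ ε k

namespace ConvBV

variable {X : Type*} {K : Set X} {f g : ℕ → X → ℝ} {L M : X → ℝ}

lemma const (h : ∃ B, ∀ x ∈ K, |L x| ≤ B) : ConvBV K (fun _ => L) L where
  tendsto _ _ := tendsto_const_nhds
  bounded := by
    obtain ⟨B, hB⟩ := h
    exact ⟨|B|, abs_nonneg B, fun _ x hx => (hB x hx).trans (le_abs_self B)⟩
  variation := ⟨fun _ => 0, summable_zero, by simp⟩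

lemma const_real (c : ℝ) : ConvBV K (fun _ _ => c) (fun _ => c) :=
  const ⟨|c|, fun _ _ => le_rfl⟩

lemma of_seq {y : ℕ → ℝ} {l : ℝ} (hy : Tendsto y atTop (𝓝 l))
    (hv : Summable fun k => |y (k + 1) - y k|) : ConvBV K (fun k _ => y k) (fun _ => l) where
  tendsto _ _ := hy
  bounded := by
    obtain ⟨B, hB⟩ := hy.abs.bddAbove_range
    exact ⟨B, (abs_nonneg _).trans (hB ⟨0, rfl⟩), fun k _ _ => hB ⟨k, rfl⟩⟩
  variation := ⟨_, hv, fun _ _ _ => le_rfl⟩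

lemma add (hf : ConvBV K f L) (hg : ConvBV K g M) :
    ConvBV K (fun k x => f k x + g k x) (fun x => L x + M x) where
  tendsto x hx := (hf.tendsto x hx).add (hg.tendsto x hx)
  bounded := by
    obtain ⟨A, hA0, hA⟩ := hf.bounded
    obtain ⟨B, hB0, hB⟩ := hg.bounded
    exact ⟨A + B, add_nonneg hA0 hB0,
      fun k x hx => (abs_add_le _ _).trans (add_le_add (hA k x hx) (hB k x hx))⟩
  variation := by
    obtain ⟨ε, hε, h1⟩ := hf.variation
    obtain ⟨δ, hδ, h2⟩ := hg.variation
    refine ⟨fun k => ε k + δ k, hε.add hδ, fun k x hx => ?_⟩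
    rw [add_sub_add_comm]
    exact (abs_add_le _ _).trans (add_le_add (h1 k x hx) (h2 k x hx))

lemma mul (hf : ConvBV K f L) (hg : ConvBV K g M) :
    ConvBV K (fun k x => f k x * g k x) (fun x => L x * M x) where
  tendsto x hx := (hf.tendsto x hx).mul (hg.tendsto x hx)
  bounded := by
    obtain ⟨A, hA0, hA⟩ := hf.bounded
    obtain ⟨B, hB0, hB⟩ := hg.bounded
    refine ⟨A * B, mul_nonneg hA0 hB0, fun k x hx => ?_⟩
    rw [abs_mul]
    exact mul_le_mul (hA k x hx) (hB k x hx) (abs_nonneg _) hA0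
  variation := by
    obtain ⟨A, hA0, hA⟩ := hf.bounded
    obtain ⟨B, hB0, hB⟩ := hg.bounded
    obtain ⟨ε, hε, h1⟩ := hf.variation
    obtain ⟨δ, hδ, h2⟩ := hg.variation
    refine ⟨fun k => ε k * B + A * δ k, (hε.mul_right B).add (hδ.mul_left A), fun k x hx => ?_⟩
    have e : f (k + 1) x * g (k + 1) x - f k x * g k x
        = (f (k + 1) x - f k x) * g (k + 1) x + f k x * (g (k + 1) x - g k x) := by ring
    rw [e]
    refine (abs_add_le _ _).trans (add_le_add ?_ ?_)
    · rw [abs_mul]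
      exact mul_le_mul (h1 k x hx) (hB _ x hx) (abs_nonneg _) ((abs_nonneg _).trans (h1 k x hx))
    · rw [abs_mul]
      exact mul_le_mul (hA k x hx) (h2 k x hx) (abs_nonneg _) hA0

lemma neg (hf : ConvBV K f L) : ConvBV K (fun k x => -f k x) (fun x => -L x) := by
  simpa using (const_real (-1)).mul hf

lemma sub (hf : ConvBV K f L) (hg : ConvBV K g M) :
    ConvBV K (fun k x => f k x - g k x) (fun x => L x - M x) := by
  simpa only [sub_eq_add_neg] using hf.add hg.neg

lemma sum {ι : Type*} (t : Finset ι) {F : ι → ℕ → X → ℝ} {G : ι → X → ℝ}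
    (h : ∀ i ∈ t, ConvBV K (F i) (G i)) :
    ConvBV K (fun k x => ∑ i ∈ t, F i k x) (fun x => ∑ i ∈ t, G i x) := by
  classical
  induction t using Finset.induction_on with
  | empty => simpa using const_real 0
  | insert i t hi ih =>
    simp only [Finset.sum_insert hi]
    exact (h i (Finset.mem_insert_self i t)).add
      (ih fun j hj => h j (Finset.mem_insert_of_mem hj))

lemma prod {ι : Type*} (t : Finset ι) {F : ι → ℕ → X → ℝ} {G : ι → X → ℝ}
    (h : ∀ i ∈ t, ConvBV K (F i) (G i)) :
    ConvBV K (fun k x => ∏ i ∈ t, F i k x) (fun x => ∏ i ∈ t, G i x) := by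
  classical
  induction t using Finset.induction_on with
  | empty => simpa using const_real 1
  | insert i t hi ih =>
    simp only [Finset.prod_insert hi]
    exact (h i (Finset.mem_insert_self i t)).mul
      (ih fun j hj => h j (Finset.mem_insert_of_mem hj))

/-- Inverses of positive sequences whose limit is positive; such a sequence is bounded away from
`0`, so that the variation of the inverse is controlled. -/
lemma inv {y : ℕ → ℝ} {l : ℝ} (h : ConvBV K (fun k _ => y k) (fun _ => l))
    (hy : ∀ k, 0 < y k) (hl : 0 < l) : ConvBV K (fun k _ => (y k)⁻¹) (fun _ => l⁻¹) := by
  rcases K.eq_empty_or_nonempty with rfl | ⟨x₀, hx₀⟩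
  · exact ⟨by simp, ⟨0, le_rfl, by simp⟩, ⟨fun _ => 0, summable_zero, by simp⟩⟩
  have ht : Tendsto (fun k => (y k)⁻¹) atTop (𝓝 l⁻¹) := (h.tendsto x₀ hx₀).inv₀ hl.ne'
  refine of_seq ht ?_
  obtain ⟨B, hB⟩ := ht.bddAbove_range
  have hB' : ∀ k, (y k)⁻¹ ≤ B := fun k => hB ⟨k, rfl⟩
  have hB0 : 0 ≤ B := (inv_pos.2 (hy 0)).le.trans (hB' 0)
  obtain ⟨ε, hε, h1⟩ := h.variation
  refine Summable.of_nonneg_of_le (fun _ => abs_nonneg _) (fun k => ?_) (hε.mul_left (B * B))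
  have e : (y (k + 1))⁻¹ - (y k)⁻¹ = -((y (k + 1))⁻¹ * (y k)⁻¹ * (y (k + 1) - y k)) := by
    have := (hy k).ne'
    have := (hy (k + 1)).ne'
    field_simp
    ring
  rw [e, abs_neg, abs_mul, abs_of_pos (mul_pos (inv_pos.2 (hy _)) (inv_pos.2 (hy _)))]
  exact mul_le_mul (mul_le_mul (hB' _) (hB' _) (inv_pos.2 (hy _)).le hB0) (h1 k x₀ hx₀)
    (abs_nonneg _) (mul_nonneg hB0 hB0)

lemma uniform (h : ConvBV K f L) {η : ℝ} (hη : 0 < η) :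
    ∃ k₀, ∀ k, k₀ ≤ k → ∀ x ∈ K, |f k x - L x| < η := by
  obtain ⟨ε, hε, h1⟩ := h.variation
  obtain ⟨k₀, hk₀⟩ := eventually_atTop.1 ((tendsto_sum_nat_add ε).eventually_lt_const hη)
  refine ⟨k₀, fun k hk x hx => lt_of_le_of_lt ?_ (hk₀ k hk)⟩
  have := dist_le_tsum_of_dist_le_of_tendsto ε
    (fun n => by rw [dist_comm, Real.dist_eq]; exact h1 n x hx) hε (h.tendsto x hx) k
  rw [Real.dist_eq] at this
  simpa only [add_comm] using this

end ConvBV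

/-- A uniform bound along each residue class modulo `N` gives a uniform bound. -/
lemma exists_bound_of_residues {X : Type*} {K : Set X} {N : ℕ} (hN : 0 < N) {f : ℕ → X → ℝ}
    (h : ∀ j, ∃ M, 0 ≤ M ∧ ∀ k, ∀ x ∈ K, |f (k * N + j) x| ≤ M) :
    ∃ M, ∀ n, ∀ x ∈ K, |f n x| ≤ M := by
  choose M hM0 hM using h
  refine ⟨∑ j ∈ Finset.range N, M j, fun n x hx => ?_⟩
  have e := hM (n % N) (n / N) x hx
  rw [Nat.div_add_mod'] at e
  exact e.trans (Finset.single_le_sum (f := M) (fun i _ => hM0 i)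
    (Finset.mem_range.2 (Nat.mod_lt n hN)))

/-- Entrywise `ConvBV` for `2 × 2` matrix functions. -/
def MatConvBV {X : Type*} (K : Set X) (F : ℕ → X → Matrix (Fin 2) (Fin 2) ℝ)
    (L : X → Matrix (Fin 2) (Fin 2) ℝ) : Prop :=
  ∀ i j, ConvBV K (fun k x => F k x i j) (fun x => L x i j)

namespace MatConvBV

variable {X : Type*} {K : Set X} {F G : ℕ → X → Matrix (Fin 2) (Fin 2) ℝ}
  {L M : X → Matrix (Fin 2) (Fin 2) ℝ}

lemma const (A : Matrix (Fin 2) (Fin 2) ℝ) : MatConvBV K (fun _ _ => A) (fun _ => A) :=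
  fun i j => ConvBV.const_real (A i j)

lemma mul (hF : MatConvBV K F L) (hG : MatConvBV K G M) :
    MatConvBV K (fun k x => F k x * G k x) (fun x => L x * M x) := by
  intro i j
  simp only [Matrix.mul_apply]
  exact ConvBV.sum _ fun l _ => (hF i l).mul (hG l j)

lemma smul {f : ℕ → X → ℝ} {l : X → ℝ} (hf : ConvBV K f l) (hF : MatConvBV K F L) :
    MatConvBV K (fun k x => f k x • F k x) (fun x => l x • L x) := by
  intro i j
  simp only [Matrix.smul_apply, smul_eq_mul]
  exact hf.mul (hF i j)

lemma sum {ι : Type*} (t : Finset ι) {F : ι → ℕ → X → Matrix (Fin 2) (Fin 2) ℝ}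
    {G : ι → X → Matrix (Fin 2) (Fin 2) ℝ} (h : ∀ i ∈ t, MatConvBV K (F i) (G i)) :
    MatConvBV K (fun k x => ∑ i ∈ t, F i k x) (fun x => ∑ i ∈ t, G i x) := by
  intro i j
  simp only [Matrix.sum_apply]
  exact ConvBV.sum _ fun l hl => h l hl i j

lemma orderedProd {C : ℕ → X → ℕ → Matrix (Fin 2) (Fin 2) ℝ}
    {D : X → ℕ → Matrix (Fin 2) (Fin 2) ℝ}
    (h : ∀ i, MatConvBV K (fun k x => C k x i) (fun x => D x i)) (i m : ℕ) :
    MatConvBV K (fun k x => orderedProd (C k x) i m) (fun x => orderedProd (D x) i m) := by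
  induction m with
  | zero => exact const 1
  | succ m ih => exact (h (i + m)).mul ih

lemma disc (h : MatConvBV K F L) :
    ConvBV K (fun k x => (F k x).trace ^ 2 - 4 * (F k x).det)
      (fun x => (L x).trace ^ 2 - 4 * (L x).det) := by
  simp only [Matrix.trace_fin_two, Matrix.det_fin_two, pow_two]
  exact (((h 0 0).add (h 1 1)).mul ((h 0 0).add (h 1 1))).sub
    ((ConvBV.const_real 4).mul (((h 0 0).mul (h 1 1)).sub ((h 0 1).mul (h 1 0))))

end MatConvBV

/-! ### Ordered products -/

lemma orderedProd_add_left (C : ℕ → Matrix (Fin 2) (Fin 2) ℝ) (m i k : ℕ) :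
    orderedProd C (m + i) k = orderedProd (fun j => C (m + j)) i k := by
  induction k with
  | zero => rfl
  | succ k ih => simp only [orderedProd, ih, add_assoc]

lemma orderedProd_add (C : ℕ → Matrix (Fin 2) (Fin 2) ℝ) (i k l : ℕ) :
    orderedProd C i (k + l) = orderedProd C (i + k) l * orderedProd C i k := by
  induction l with
  | zero => simp [orderedProd]
  | succ l ih => rw [← add_assoc, orderedProd, ih, orderedProd, add_assoc, Matrix.mul_assoc]

lemma det_orderedProd (C : ℕ → Matrix (Fin 2) (Fin 2) ℝ) (i k : ℕ) :
    (orderedProd C i k).det = ∏ j ∈ Finset.Ico i (i + k), (C j).det := by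
  induction k with
  | zero => simp [orderedProd]
  | succ k ih =>
    rw [orderedProd, Matrix.det_mul, ih, ← add_assoc, Finset.prod_Ico_succ_top (by omega),
      mul_comm]

/-- Exchanging the factors of an ordered product one at a time. -/
lemma orderedProd_sub (C D : ℕ → Matrix (Fin 2) (Fin 2) ℝ) (k : ℕ) :
    orderedProd C 0 k - orderedProd D 0 k = ∑ j ∈ Finset.range k,
      orderedProd C (j + 1) (k - 1 - j) * (C j - D j) * orderedProd D 0 j := by
  induction k with
  | zero => simp [orderedProd]
  | succ k ih =>
    have e : ∀ j ∈ Finset.range k, orderedProd C (j + 1) (k + 1 - 1 - j) * (C j - D j)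
        * orderedProd D 0 j
        = C k * (orderedProd C (j + 1) (k - 1 - j) * (C j - D j) * orderedProd D 0 j) := by
      intro j hj
      have hj' := Finset.mem_range.1 hj
      obtain ⟨l, rfl⟩ : ∃ l, k = j + 1 + l := ⟨k - (j + 1), by omega⟩
      rw [show j + 1 + l + 1 - 1 - j = l + 1 by omega, show j + 1 + l - 1 - j = l by omega,
        orderedProd]
      simp only [Matrix.mul_assoc]
    rw [Finset.sum_range_succ, Finset.sum_congr rfl e, ← Finset.mul_sum, ← ih]
    simp only [orderedProd, add_tsub_cancel_right, tsub_self, zero_add, Matrix.one_mul,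
      mul_sub, sub_mul]
    abel

/-! ### The Turán form of a matrix -/

/-- The quadratic form `v ↦ det (M v, v)`. It vanishes on multiples of the identity. -/
def turanForm (M : Matrix (Fin 2) (Fin 2) ℝ) (v : Fin 2 → ℝ) : ℝ :=
  (M *ᵥ v) 0 * v 1 - (M *ᵥ v) 1 * v 0

lemma turanForm_eq (M : Matrix (Fin 2) (Fin 2) ℝ) (v : Fin 2 → ℝ) :
    turanForm M v = -M 1 0 * v 0 ^ 2 + (M 0 0 - M 1 1) * (v 0 * v 1) + M 0 1 * v 1 ^ 2 := by
  simp only [turanForm, Matrix.mulVec, dotProduct, Fin.sum_univ_two]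
  ring

lemma turanForm_add (M M' : Matrix (Fin 2) (Fin 2) ℝ) (v : Fin 2 → ℝ) :
    turanForm (M + M') v = turanForm M v + turanForm M' v := by
  simp only [turanForm_eq, Matrix.add_apply]
  ring

lemma turanForm_sub (M M' : Matrix (Fin 2) (Fin 2) ℝ) (v : Fin 2 → ℝ) :
    turanForm (M - M') v = turanForm M v - turanForm M' v := by
  simp only [turanForm_eq, Matrix.sub_apply]
  ring

lemma turanForm_smul (c : ℝ) (M : Matrix (Fin 2) (Fin 2) ℝ) (v : Fin 2 → ℝ) :
    turanForm (c • M) v = c * turanForm M v := by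
  simp only [turanForm_eq, Matrix.smul_apply, smul_eq_mul]
  ring

lemma turanForm_one (v : Fin 2 → ℝ) : turanForm 1 v = 0 := by
  simp [turanForm_eq]

lemma turanForm_sum {ι : Type*} (t : Finset ι) (F : ι → Matrix (Fin 2) (Fin 2) ℝ)
    (v : Fin 2 → ℝ) : turanForm (∑ i ∈ t, F i) v = ∑ i ∈ t, turanForm (F i) v := by
  classical
  induction t using Finset.induction_on with
  | empty => simp [turanForm_eq]
  | insert i t hi ih => rw [Finset.sum_insert hi, Finset.sum_insert hi, turanForm_add, ih]

/-- Multiplying both columns of `(M v, v)` by `M` scales the determinant by `det M`. -/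
lemma turanForm_mulVec_self (M : Matrix (Fin 2) (Fin 2) ℝ) (v : Fin 2 → ℝ) :
    turanForm M (M *ᵥ v) = M.det * turanForm M v := by
  simp only [turanForm, Matrix.mulVec, dotProduct, Fin.sum_univ_two, Matrix.det_fin_two]
  ring

lemma abs_turanForm_le {M : Matrix (Fin 2) (Fin 2) ℝ} {B : ℝ} (hM : ∀ i j, |M i j| ≤ B)
    (v : Fin 2 → ℝ) : |turanForm M v| ≤ 2 * B * (v 0 ^ 2 + v 1 ^ 2) := by
  have h00 := abs_le.1 (hM 0 0)
  have h01 := abs_le.1 (hM 0 1)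
  have h10 := abs_le.1 (hM 1 0)
  have h11 := abs_le.1 (hM 1 1)
  have hd : |(M 0 0 - M 1 1) * (v 0 * v 1)| ≤ (2 * B) * ((v 0 ^ 2 + v 1 ^ 2) / 2) := by
    rw [abs_mul]
    refine mul_le_mul (abs_le.2 ⟨by linarith, by linarith⟩) (abs_le.2 ⟨?_, ?_⟩) (abs_nonneg _)
      (by linarith)
    · linarith [sq_nonneg (v 0 + v 1)]
    · linarith [sq_nonneg (v 0 - v 1)]
  have hd' := abs_le.1 hd
  have p0 := sq_nonneg (v 0)
  have p1 := sq_nonneg (v 1)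
  rw [turanForm_eq, abs_le]
  constructor <;>
    linarith [mul_le_mul_of_nonneg_right h10.1 p0, mul_le_mul_of_nonneg_right h10.2 p0,
      mul_le_mul_of_nonneg_right h01.1 p1, mul_le_mul_of_nonneg_right h01.2 p1]

/-- The trace of the symmetric matrix of the form, times the form, dominates its determinant (that
is `-1/4` of the discriminant) times `v 0 ^ 2 + v 1 ^ 2`. -/
lemma disc_mul_le (M : Matrix (Fin 2) (Fin 2) ℝ) (v : Fin 2 → ℝ) :
    -(M.trace ^ 2 - 4 * M.det) * (v 0 ^ 2 + v 1 ^ 2)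
      ≤ 4 * (M 0 1 - M 1 0) * turanForm M v := by
  rw [turanForm_eq, Matrix.trace_fin_two, Matrix.det_fin_two]
  linarith [sq_nonneg (-2 * M 1 0 * v 0 + (M 0 0 - M 1 1) * v 1),
    sq_nonneg (2 * M 0 1 * v 1 + (M 0 0 - M 1 1) * v 0)]

lemma le_abs_turanForm {M : Matrix (Fin 2) (Fin 2) ℝ} {B d : ℝ} (hM : ∀ i j, |M i j| ≤ B)
    (hd : M.trace ^ 2 - 4 * M.det ≤ -d) (v : Fin 2 → ℝ) :
    d * (v 0 ^ 2 + v 1 ^ 2) ≤ 8 * B * |turanForm M v| := by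
  have h01 := abs_le.1 (hM 0 1)
  have h10 := abs_le.1 (hM 1 0)
  have h1 : (M 0 1 - M 1 0) * turanForm M v ≤ 2 * B * |turanForm M v| := by
    refine (le_abs_self _).trans ?_
    rw [abs_mul]
    exact mul_le_mul_of_nonneg_right (abs_le.2 ⟨by linarith, by linarith⟩) (abs_nonneg _)
  have h2 : d * (v 0 ^ 2 + v 1 ^ 2) ≤ -(M.trace ^ 2 - 4 * M.det) * (v 0 ^ 2 + v 1 ^ 2) :=
    mul_le_mul_of_nonneg_right (by linarith) (by positivity)
  linarith [disc_mul_le M v]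

lemma sq_add_sq_pos {v : Fin 2 → ℝ} (hv : v ≠ 0) : 0 < v 0 ^ 2 + v 1 ^ 2 := by
  by_contra h
  have h0 : v 0 = 0 := by nlinarith [sq_nonneg (v 0), sq_nonneg (v 1)]
  have h1 : v 1 = 0 := by nlinarith [sq_nonneg (v 0), sq_nonneg (v 1)]
  exact hv (by ext i; fin_cases i <;> assumption)

lemma disc_nonneg_iff (M : Matrix (Fin 2) (Fin 2) ℝ) :
    0 ≤ M.trace ^ 2 - 4 * M.det ↔ ∃ v : Fin 2 → ℝ, v ≠ 0 ∧ turanForm M v = 0 := by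
  constructor
  · intro h
    by_cases h10 : M 1 0 = 0
    · exact ⟨![1, 0], fun e => by simpa using congrFun e 0, by simp [turanForm_eq, h10]⟩
    · refine ⟨![M 0 0 - M 1 1 + √(M.trace ^ 2 - 4 * M.det), 2 * M 1 0],
        fun e => h10 (by simpa using congrFun e 1), ?_⟩
      have hs := Real.sq_sqrt h
      rw [turanForm_eq]
      simp only [Matrix.cons_val_zero, Matrix.cons_val_one]
      generalize √(M.trace ^ 2 - 4 * M.det) = t at hs
      rw [Matrix.trace_fin_two, Matrix.det_fin_two] at hs
      linear_combination (-M 1 0) * hs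
  · rintro ⟨v, hv, h⟩
    have h1 := disc_mul_le M v
    rw [h, mul_zero] at h1
    by_contra hneg
    linarith [mul_pos (neg_pos.2 (not_le.1 hneg)) (sq_add_sq_pos hv)]

/-- Along a pencil `M₀ + x M₁` whose direction `M₁` has a definite Turán form, the discriminant is a
quadratic polynomial in `x` with negative leading coefficient. It is nonnegative somewhere, because
for fixed `v ≠ 0` the form at `v` is a nonconstant affine function of `x`. -/
lemma disc_pencil_nonneg_eq_Icc (M₀ M₁ : Matrix (Fin 2) (Fin 2) ℝ)
    (h : ∀ v : Fin 2 → ℝ, v ≠ 0 → turanForm M₁ v ≠ 0) :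
    ∃ x₁ x₂ : ℝ, x₁ ≤ x₂ ∧
      {x : ℝ | 0 ≤ (M₀ + x • M₁).trace ^ 2 - 4 * (M₀ + x • M₁).det} = Set.Icc x₁ x₂ := by
  have hlead : M₁.trace ^ 2 - 4 * M₁.det < 0 := by
    by_contra hneg
    obtain ⟨v, hv, hv0⟩ := (disc_nonneg_iff M₁).1 (not_lt.1 hneg)
    exact h v hv hv0
  obtain ⟨x₀, hx₀⟩ : ∃ x : ℝ, 0 ≤ (M₀ + x • M₁).trace ^ 2 - 4 * (M₀ + x • M₁).det := by
    have hv : (![1, 0] : Fin 2 → ℝ) ≠ 0 := fun e => by simpa using congrFun e 0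
    refine ⟨-turanForm M₀ ![1, 0] / turanForm M₁ ![1, 0],
      (disc_nonneg_iff _).2 ⟨![1, 0], hv, ?_⟩⟩
    rw [turanForm_add, turanForm_smul, div_mul_cancel₀ _ (h _ hv), add_neg_cancel]
  set A := -(M₁.trace ^ 2 - 4 * M₁.det) with hA
  set B := M₀.trace * M₁.trace - 2 * (M₀ 0 0 * M₁ 1 1 + M₁ 0 0 * M₀ 1 1 - M₀ 0 1 * M₁ 1 0
    - M₁ 0 1 * M₀ 1 0) with hB
  set C := M₀.trace ^ 2 - 4 * M₀.det with hC
  have hA0 : 0 < A := by linarith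
  have e : ∀ x : ℝ, A * ((M₀ + x • M₁).trace ^ 2 - 4 * (M₀ + x • M₁).det)
      = (B ^ 2 + A * C) - (A * x - B) ^ 2 := by
    intro x
    simp only [hA, hB, hC, Matrix.trace_fin_two, Matrix.det_fin_two, Matrix.add_apply,
      Matrix.smul_apply, smul_eq_mul]
    ring
  have hD : 0 ≤ B ^ 2 + A * C := by
    linarith [e x₀, mul_nonneg hA0.le hx₀, sq_nonneg (A * x₀ - B)]
  refine ⟨(B - √(B ^ 2 + A * C)) / A, (B + √(B ^ 2 + A * C)) / A, ?_, ?_⟩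
  · have := Real.sqrt_nonneg (B ^ 2 + A * C)
    gcongr
    linarith
  · ext x
    rw [Set.mem_ofPred_eq, Set.mem_Icc, div_le_iff₀ hA0, le_div_iff₀ hA0,
      ← mul_nonneg_iff_of_pos_left hA0, e, sub_nonneg, Real.sq_le hD]
    constructor <;> rintro ⟨h1, h2⟩ <;> constructor <;> linarith

/-! ### The exceptional set is an interval -/

lemma det_stepMatrix (r q : ℕ → ℝ) (i : ℕ) : (stepMatrix r q i).det = r i := by
  simp [stepMatrix, Matrix.det_fin_two]

/-- The coefficient of `x` in `limitMatrix`. -/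
noncomputable def limitSlope (N : ℕ) (r q : ℕ → ℝ) : Matrix (Fin 2) (Fin 2) ℝ :=
  ∑ j ∈ Finset.range N, (weight N r j)⁻¹ •
    (orderedProd (stepMatrix r q) (j + 1) (N - 1 - j) * !![0, 0; 0, 1] *
      orderedProd (stepMatrix r q) 0 j)

lemma limitMatrix_eq (N : ℕ) (r q s z : ℕ → ℝ) (x : ℝ) :
    limitMatrix N r q s z x = limitMatrix N r q s z 0 + x • limitSlope N r q := by
  rw [limitMatrix, limitMatrix, limitSlope, Finset.smul_sum, ← Finset.sum_add_distrib]
  refine Finset.sum_congr rfl fun j _ => ?_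
  have e : (!![0, 0; s j, x - z j] : Matrix (Fin 2) (Fin 2) ℝ)
      = !![0, 0; s j, 0 - z j] + x • !![0, 0; 0, 1] := by
    ext i k
    fin_cases i <;> fin_cases k <;> simp
    ring
  rw [e, Matrix.mul_add, Matrix.add_mul, smul_add, Matrix.mul_smul, Matrix.smul_mul,
    smul_comm x]

lemma weight_eq_det {N j : ℕ} (hj : j < N) (r q : ℕ → ℝ) :
    weight N r j = (orderedProd (stepMatrix r q) (j + 1) (N - 1 - j)).det := by
  rw [det_orderedProd, weight, show j + 1 + (N - 1 - j) = N by omega]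
  simp only [det_stepMatrix]

/-- If `P B Q = γ` with `γ² = 1` then `v = γ P B (Q v)`, so the factor `P` can be pulled out of the
determinant `det (P D Q v, v)` for every `D`. -/
lemma turanForm_mul_mul {P B Q : Matrix (Fin 2) (Fin 2) ℝ} {γ : ℝ} (hγ : γ ^ 2 = 1)
    (h : P * B * Q = γ • (1 : Matrix (Fin 2) (Fin 2) ℝ)) (D : Matrix (Fin 2) (Fin 2) ℝ)
    (v : Fin 2 → ℝ) :
    turanForm (P * D * Q) v = γ * P.det * ((D *ᵥ (Q *ᵥ v)) 0 * (B *ᵥ (Q *ᵥ v)) 1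
      - (D *ᵥ (Q *ᵥ v)) 1 * (B *ᵥ (Q *ᵥ v)) 0) := by
  have hv : v = γ • (P *ᵥ (B *ᵥ (Q *ᵥ v))) := by
    rw [Matrix.mulVec_mulVec, Matrix.mulVec_mulVec, h, Matrix.smul_mulVec,
      Matrix.one_mulVec, smul_smul, ← pow_two, hγ, one_smul]
  have hL : (P * D * Q) *ᵥ v = P *ᵥ (D *ᵥ (Q *ᵥ v)) := by
    rw [Matrix.mulVec_mulVec, Matrix.mulVec_mulVec]
  rw [turanForm, hL]
  generalize Q *ᵥ v = w at hv ⊢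
  rw [hv]
  simp only [Matrix.mulVec, dotProduct, Fin.sum_univ_two, Matrix.det_fin_two, Pi.smul_apply,
    smul_eq_mul]
  ring

section Interval

variable {N : ℕ} {r q : ℕ → ℝ} {γ : ℝ}

lemma turanForm_limitSlope (hr : ∀ i, r i ≠ 0) (hγ : γ ^ 2 = 1)
    (hprod : orderedProd (stepMatrix r q) 0 N = γ • (1 : Matrix (Fin 2) (Fin 2) ℝ))
    (v : Fin 2 → ℝ) :
    turanForm (limitSlope N r q) v
      = -γ * ∑ j ∈ Finset.range N, ((orderedProd (stepMatrix r q) 0 j *ᵥ v) 1) ^ 2 := by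
  rw [limitSlope, turanForm_sum, Finset.mul_sum]
  refine Finset.sum_congr rfl fun j hj => ?_
  have hj' := Finset.mem_range.1 hj
  have hp : orderedProd (stepMatrix r q) (j + 1) (N - 1 - j) * stepMatrix r q j
      * orderedProd (stepMatrix r q) 0 j = γ • (1 : Matrix (Fin 2) (Fin 2) ℝ) := by
    have e := orderedProd_add (stepMatrix r q) 0 (j + 1) (N - 1 - j)
    rw [show j + 1 + (N - 1 - j) = N by omega, hprod, zero_add, orderedProd, zero_add] at e
    rw [e, Matrix.mul_assoc]
  have hw : weight N r j ≠ 0 := Finset.prod_ne_zero_iff.2 fun i _ => hr i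
  rw [turanForm_smul, turanForm_mul_mul hγ hp, ← weight_eq_det hj', ← mul_assoc, mul_left_comm,
    inv_mul_cancel₀ hw, mul_one, neg_mul, ← mul_neg]
  congr 1
  simp [Matrix.mulVec, dotProduct, Fin.sum_univ_two, stepMatrix]
  ring

/-- A single matrix `(0, 1; -r, -q)` is not a multiple of the identity. -/
lemma two_le_of_orderedProd_eq (hN : 0 < N)
    (hprod : orderedProd (stepMatrix r q) 0 N = γ • (1 : Matrix (Fin 2) (Fin 2) ℝ)) : 2 ≤ N := by
  by_contra h
  obtain rfl : N = 1 := by omega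
  have := congrFun (congrFun hprod 0) 1
  simp [orderedProd, stepMatrix] at this

lemma turanForm_limitSlope_ne_zero (hN : 0 < N) (hr : ∀ i, r i ≠ 0) (hγ : γ ^ 2 = 1)
    (hprod : orderedProd (stepMatrix r q) 0 N = γ • (1 : Matrix (Fin 2) (Fin 2) ℝ))
    {v : Fin 2 → ℝ} (hv : v ≠ 0) : turanForm (limitSlope N r q) v ≠ 0 := by
  have hN2 := two_le_of_orderedProd_eq hN hprod
  have hγ0 : γ ≠ 0 := by
    rintro rfl
    norm_num at hγ
  rw [turanForm_limitSlope hr hγ hprod]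
  refine mul_ne_zero (neg_ne_zero.2 hγ0) fun h0 => hv ?_
  rw [Finset.sum_eq_zero_iff_of_nonneg fun _ _ => sq_nonneg _] at h0
  -- The terms `j = 0` and `j = 1` are `v 1` and `-r 0 * v 0 - q 0 * v 1`.
  have e0 := h0 0 (Finset.mem_range.2 hN)
  have e1 := h0 1 (Finset.mem_range.2 hN2)
  simp [orderedProd, stepMatrix, Matrix.mulVec, dotProduct, Fin.sum_univ_two] at e0 e1
  rw [e0] at e1
  have e2 : v 0 = 0 := by simpa [hr 0] using e1
  ext i
  fin_cases i <;> assumption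

lemma exceptionalSet_eq_Icc (s z : ℕ → ℝ) (hN : 0 < N) (hr : ∀ i, r i ≠ 0) (hγ : γ ^ 2 = 1)
    (hprod : orderedProd (stepMatrix r q) 0 N = γ • (1 : Matrix (Fin 2) (Fin 2) ℝ)) :
    ∃ x₁ x₂ : ℝ, x₁ ≤ x₂ ∧ exceptionalSet N r q s z = Set.Icc x₁ x₂ := by
  obtain ⟨x₁, x₂, h12, h⟩ := disc_pencil_nonneg_eq_Icc (limitMatrix N r q s z 0)
    (limitSlope N r q) fun v hv => turanForm_limitSlope_ne_zero hN hr hγ hprod hv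
  refine ⟨x₁, x₂, h12, ?_⟩
  rw [← h]
  ext x
  rw [exceptionalSet, Set.mem_ofPred_eq, Set.mem_ofPred_eq, ← limitMatrix_eq]

end Interval

/-! ### Comparable quantities -/

/-- Two quantities each bounded by `C` times the other. -/
def Comparable (C p q : ℝ) : Prop := p ≤ C * q ∧ q ≤ C * p

namespace Comparable

variable {C D p q t : ℝ}

lemma refl (p : ℝ) : Comparable 1 p p := by simp [Comparable]

lemma symm (h : Comparable C p q) : Comparable C q p := ⟨h.2, h.1⟩

lemma trans (h : Comparable C p q) (h' : Comparable D q t) (hC : 0 ≤ C) (hD : 0 ≤ D) :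
    Comparable (C * D) p t :=
  ⟨h.1.trans (by rw [mul_assoc]; exact mul_le_mul_of_nonneg_left h'.1 hC),
    h'.2.trans (by rw [mul_comm C, mul_assoc]; exact mul_le_mul_of_nonneg_left h.2 hD)⟩

lemma mono (h : Comparable C p q) (hCD : C ≤ D) (hp : 0 ≤ p) (hq : 0 ≤ q) : Comparable D p q :=
  ⟨h.1.trans (mul_le_mul_of_nonneg_right hCD hq), h.2.trans (mul_le_mul_of_nonneg_right hCD hp)⟩

end Comparable

/-- A sequence whose relative increments are summable stays comparable to its value at `k₀`. -/
lemma comparable_of_summable_increments {η : ℕ → ℝ} (hη : Summable η) (hη0 : ∀ k, 0 ≤ η k)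
    {k₀ : ℕ} (hsmall : ∀ k, k₀ ≤ k → η k ≤ 1 / 2) {t : ℕ → ℝ} (ht : ∀ k, 0 ≤ t k)
    (hstep : ∀ k, k₀ ≤ k → |t (k + 1) - t k| ≤ η k * t (k + 1)) {k : ℕ} (hk : k₀ ≤ k) :
    Comparable (Real.exp (2 * ∑' i, η i)) (t k) (t k₀) := by
  have key : Comparable (Real.exp (2 * ∑ i ∈ Finset.range k, η i)) (t k) (t k₀) := by
    induction k, hk using Nat.le_induction with
    | base =>
      refine (Comparable.refl _).mono (Real.one_le_exp ?_) (ht _) (ht _)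
      exact mul_nonneg zero_le_two (Finset.sum_nonneg fun i _ => hη0 i)
    | succ k hk ih =>
      have h1 := abs_le.1 (hstep k hk)
      have h2 := hsmall k hk
      have h3 : 1 + 2 * η k ≤ Real.exp (2 * η k) := by linarith [Real.add_one_le_exp (2 * η k)]
      have hc : Comparable (Real.exp (2 * η k)) (t (k + 1)) (t k) := by
        constructor
        · refine le_trans ?_ (mul_le_mul_of_nonneg_right h3 (ht k))
          -- `(1 - η) (1 + 2 η) = 1 + η (1 - 2 η) ≥ 1` for `0 ≤ η ≤ 1 / 2`
          have h4 : 0 ≤ η k * (1 - 2 * η k) * t (k + 1) :=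
            mul_nonneg (mul_nonneg (hη0 k) (by linarith)) (ht _)
          have h5 : (1 + 2 * η k) * (t (k + 1) - η k * t (k + 1)) ≤ (1 + 2 * η k) * t k :=
            mul_le_mul_of_nonneg_left (by linarith) (by linarith [hη0 k])
          linarith
        · refine le_trans ?_ (mul_le_mul_of_nonneg_right h3 (ht (k + 1)))
          linarith [mul_nonneg (hη0 k) (ht (k + 1))]
      rw [Finset.sum_range_succ, mul_add, add_comm, Real.exp_add]
      exact hc.trans ih (Real.exp_pos _).le (Real.exp_pos _).le
  refine key.mono (Real.exp_le_exp.2 ?_) (ht _) (ht _)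
  linarith [hη.sum_le_tsum (Finset.range k) fun i _ => hη0 i]

lemma comparable_add {c : ℝ} (hc : 1 ≤ c) {y : ℕ → ℝ}
    (hstep : ∀ n, 1 ≤ n → Comparable c (y (n + 1)) (y n)) {n : ℕ} (hn : 1 ≤ n) (m : ℕ) :
    Comparable (c ^ m) (y (n + m)) (y n) := by
  induction m with
  | zero => simpa using Comparable.refl (y n)
  | succ m ih =>
    rw [pow_succ']
    exact (hstep (n + m) (by omega)).trans ih (by linarith) (by positivity)

/-- Comparability along the multiples of `N`, together with comparability of neighbouring terms,
gives comparability of all terms. -/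
lemma comparable_of_comparable_mul {N : ℕ} (hN : 0 < N) {c E : ℝ} (hc : 1 ≤ c) (hE : 1 ≤ E)
    {k₀ : ℕ} {y : ℕ → ℝ} (hy : ∀ n, 0 ≤ y n)
    (hstep : ∀ n, 1 ≤ n → Comparable c (y (n + 1)) (y n))
    (hblock : ∀ k, k₀ ≤ k → Comparable E (y ((k + 1) * N)) (y ((k₀ + 1) * N)))
    {n : ℕ} (hn : 1 ≤ n) :
    Comparable (c ^ N * E * c ^ ((k₀ + 1) * N)) (y n) (y 1) := by
  have hc0 : 0 ≤ c := by linarith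
  have hfirst : ∀ n, 1 ≤ n → n ≤ (k₀ + 1) * N →
      Comparable (c ^ ((k₀ + 1) * N)) (y n) (y 1) := by
    intro n h1 h2
    obtain ⟨m, rfl⟩ := Nat.exists_eq_add_of_le h1
    exact (comparable_add hc hstep le_rfl m).mono (pow_le_pow_right₀ hc (by omega)) (hy _) (hy _)
  rcases le_total n ((k₀ + 1) * N) with h | h
  · refine (hfirst n hn h).mono (le_mul_of_one_le_left (by positivity) ?_) (hy _) (hy _)
    exact one_le_mul_of_one_le_of_one_le (one_le_pow₀ hc) hE
  · have hdiv : k₀ + 1 ≤ n / N := (Nat.le_div_iff_mul_le hN).2 h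
    obtain ⟨k, hk⟩ := Nat.exists_eq_add_of_le' (le_trans (Nat.le_add_left 1 k₀) hdiv)
    have hnk : (k + 1) * N + n % N = n := by rw [← hk, Nat.div_add_mod']
    have h1 : Comparable (c ^ N) (y n) (y ((k + 1) * N)) := by
      have := comparable_add hc hstep (n := (k + 1) * N) (by nlinarith) (n % N)
      rw [hnk] at this
      exact this.mono (pow_le_pow_right₀ hc (Nat.mod_lt n hN).le) (hy _) (hy _)
    have h2 := hfirst ((k₀ + 1) * N) (by nlinarith) le_rfl
    exact (h1.trans (hblock k (by omega)) (by positivity) (by linarith)).trans h2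
      (by positivity) (by positivity)

/-! ### Transfer matrices -/

/-- The transfer matrix `(0, 1; -a_{n-1} / a_n, (x - b_n) / a_n)`, which maps `(u_{n-1}, u_n)` to
`(u_n, u_{n+1})` for `n ≥ 1`. -/
noncomputable def transferMatrix (a b : ℕ → ℝ) (x : ℝ) (n : ℕ) : Matrix (Fin 2) (Fin 2) ℝ :=
  !![0, 1; -(a (n - 1) / a n), (x - b n) / a n]

/-- `a n` times the difference of `transferMatrix a b x n` and `stepMatrix r q n`. -/
def perturbation (a b r q : ℕ → ℝ) (x : ℝ) (n : ℕ) : Matrix (Fin 2) (Fin 2) ℝ :=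
  !![0, 0; r n * a n - a (n - 1), x - (b n - q n * a n)]

/-- The vector `(u_{n-1}, u_n)`. -/
def state (u : ℕ → ℝ) (n : ℕ) : Fin 2 → ℝ := ![u (n - 1), u n]

section Transfer

variable {a b r q u : ℕ → ℝ} {x : ℝ}

lemma transferMatrix_sub_stepMatrix (ha : ∀ n, 0 < a n) (n : ℕ) :
    transferMatrix a b x n - stepMatrix r q n = (a n)⁻¹ • perturbation a b r q x n := by
  have := (ha n).ne'
  ext i j
  fin_cases i <;> fin_cases j <;> simp [transferMatrix, stepMatrix, perturbation] <;>
    field_simp <;> ring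

lemma state_succ (ha : ∀ n, 0 < a n) (hu : IsGeneralizedEigenvector a b x u) {n : ℕ}
    (hn : 1 ≤ n) : state u (n + 1) = transferMatrix a b x n *ᵥ state u n := by
  have h := hu n hn
  have := (ha n).ne'
  ext i
  fin_cases i
  · simp [state, transferMatrix, Matrix.mulVec, dotProduct, Fin.sum_univ_two]
  · simp [state, transferMatrix, Matrix.mulVec, dotProduct, Fin.sum_univ_two]
    field_simp
    linarith

lemma state_add (ha : ∀ n, 0 < a n) (hu : IsGeneralizedEigenvector a b x u) {n : ℕ}
    (hn : 1 ≤ n) (m : ℕ) :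
    state u (n + m) = orderedProd (transferMatrix a b x) n m *ᵥ state u n := by
  induction m with
  | zero => simp [orderedProd]
  | succ m ih =>
    rw [← add_assoc, state_succ ha hu (by omega), ih, Matrix.mulVec_mulVec, orderedProd]

lemma det_orderedProd_transferMatrix (ha : ∀ n, 0 < a n) (n m : ℕ) :
    (orderedProd (transferMatrix a b x) n m).det = a (n - 1) / a (n + m - 1) := by
  induction m with
  | zero => simp [orderedProd, (ha _).ne']
  | succ m ih =>
    have := (ha (n + m)).ne'
    have := (ha (n + m - 1)).ne'
    rw [orderedProd, Matrix.det_mul, ih, Matrix.det_fin_two, transferMatrix]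
    simp
    field_simp

/-- The rescaled deviation `a_{kN+N-1} (X - γ)` of the `N`-step transfer matrix `X` that starts at
`k N`, in telescoped form. -/
noncomputable def blockRemainder (N : ℕ) (a b r q : ℕ → ℝ) (k : ℕ) (x : ℝ) :
    Matrix (Fin 2) (Fin 2) ℝ :=
  ∑ j ∈ Finset.range N, (a (k * N + (N - 1)) / a (k * N + j)) •
    (orderedProd (fun i => transferMatrix a b x (k * N + i)) (j + 1) (N - 1 - j) *
      perturbation a b r q x (k * N + j) * orderedProd (stepMatrix r q) 0 j)

lemma orderedProd_transferMatrix_eq {N : ℕ} {γ : ℝ} (ha : ∀ n, 0 < a n)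
    (hr : Function.Periodic r N) (hq : Function.Periodic q N)
    (hprod : orderedProd (stepMatrix r q) 0 N = γ • (1 : Matrix (Fin 2) (Fin 2) ℝ)) (k : ℕ) :
    orderedProd (transferMatrix a b x) (k * N) N
      = γ • (1 : Matrix (Fin 2) (Fin 2) ℝ)
        + (a (k * N + (N - 1)))⁻¹ • blockRemainder N a b r q k x := by
  have hstep : ∀ j, stepMatrix r q (k * N + j) = stepMatrix r q j := by
    intro j
    have h1 := hr.nsmul k j
    have h2 := hq.nsmul k j
    rw [smul_eq_mul, add_comm] at h1 h2
    rw [stepMatrix, stepMatrix, h1, h2]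
  have h := orderedProd_sub (fun i => transferMatrix a b x (k * N + i)) (stepMatrix r q) N
  rw [← orderedProd_add_left, add_zero, hprod] at h
  rw [← sub_eq_iff_eq_add', h, blockRemainder, Finset.smul_sum]
  refine Finset.sum_congr rfl fun j _ => ?_
  have h1 := transferMatrix_sub_stepMatrix (b := b) (r := r) (q := q) (x := x) ha (k * N + j)
  rw [hstep] at h1
  have h2 := (ha (k * N + (N - 1))).ne'
  rw [h1, Matrix.mul_smul, Matrix.smul_mul, smul_smul, div_eq_mul_inv, inv_mul_cancel_left₀ h2]

/-- The Turán form of the `N`-step transfer matrix, evaluated along a generalised eigenvector,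
changes only through the change of `blockRemainder`. -/
lemma turan_step {N : ℕ} {γ : ℝ} (hN : 0 < N) (ha : ∀ n, 0 < a n)
    (hr : Function.Periodic r N) (hq : Function.Periodic q N)
    (hprod : orderedProd (stepMatrix r q) 0 N = γ • (1 : Matrix (Fin 2) (Fin 2) ℝ))
    (hu : IsGeneralizedEigenvector a b x u) (k : ℕ) :
    a ((k + 1) * N + (N - 1))
        * turanForm (blockRemainder N a b r q (k + 1) x) (state u ((k + 1 + 1) * N))
      = a (k * N + (N - 1))
        * turanForm (blockRemainder N a b r q (k + 1) x) (state u ((k + 1) * N)) := by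
  have hn : 1 ≤ (k + 1) * N := by nlinarith
  have hX := orderedProd_transferMatrix_eq (b := b) (x := x) ha hr hq hprod (k + 1)
  have hdet := det_orderedProd_transferMatrix (b := b) (x := x) ha ((k + 1) * N) N
  have hst := state_add ha hu hn N
  rw [show (k + 1) * N + N = (k + 1 + 1) * N by ring] at hst
  rw [show (k + 1) * N - 1 = k * N + (N - 1) by rw [add_mul, one_mul]; omega,
    show (k + 1) * N + N - 1 = (k + 1) * N + (N - 1) by omega] at hdet
  have hform : ∀ v, turanForm (orderedProd (transferMatrix a b x) ((k + 1) * N) N) v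
      = (a ((k + 1) * N + (N - 1)))⁻¹ * turanForm (blockRemainder N a b r q (k + 1) x) v := by
    intro v
    rw [hX, turanForm_add, turanForm_smul, turanForm_one, mul_zero, zero_add, turanForm_smul]
  have h := turanForm_mulVec_self (orderedProd (transferMatrix a b x) ((k + 1) * N) N)
    (state u ((k + 1) * N))
  rw [← hst, hform, hform, hdet] at h
  have := (ha ((k + 1) * N + (N - 1))).ne'
  field_simp at h
  linarith

end Transfer

/-! ### Convergence of the block remainders -/

/-- The asymptotic content of the hypotheses on `a` and `b`, along every residue class modulo `N`.
The sequences are viewed as families of constant functions, so that they can be combined with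
functions of the spectral parameter. At `k = i = 0` the index `k * N + i - 1` is truncated to `0`;
a single term does not affect the conditions. -/
structure IsPeriodicPerturbation (N : ℕ) (a b r q s z : ℕ → ℝ) : Prop where
  pos : ∀ n, 0 < a n
  r_pos : ∀ i, 0 < r i
  inv : ∀ (K : Set ℝ) (i : ℕ), ConvBV K (fun k _ => (a (k * N + i))⁻¹) (fun _ => 0)
  left : ∀ (K : Set ℝ) (i : ℕ),
    ConvBV K (fun k _ => r (k * N + i) * a (k * N + i) - a (k * N + i - 1)) (fun _ => s i)
  diag : ∀ (K : Set ℝ) (i : ℕ),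
    ConvBV K (fun k _ => b (k * N + i) - q (k * N + i) * a (k * N + i)) (fun _ => z i)
  r_periodic : Function.Periodic r N
  q_periodic : Function.Periodic q N

lemma periodic_mul_add {N : ℕ} {y : ℕ → ℝ} (h : Function.Periodic y N) (k i : ℕ) :
    y (k * N + i) = y i := by
  have := h.nsmul k i
  rwa [smul_eq_mul, add_comm] at this

lemma summable_variation {N m : ℕ} (hN : 0 < N) {y : ℕ → ℝ} (h : totalVariation N m y < ∞)
    (i : ℕ) : Summable fun k => |y ((k + 1) * N + i) - y (k * N + i)| := by
  have h1 : Summable fun n => |y (n + m + N) - y (n + m)| := by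
    have := ENNReal.summable_toReal h.ne
    simpa only [ENNReal.toReal_ofReal (abs_nonneg _), add_comm m] using this
  have h2 : Summable fun n => |y (n + N) - y n| :=
    (summable_nat_add_iff (f := fun n => |y (n + N) - y n|) m).1 h1
  have hinj : Function.Injective fun k => k * N + i := by
    intro k l hkl
    exact Nat.eq_of_mul_eq_mul_right hN (Nat.add_right_cancel hkl)
  refine (h2.comp_injective hinj).congr fun k => ?_
  simp only [Function.comp_apply]
  rw [show k * N + i + N = (k + 1) * N + i by ring]

lemma tendsto_mul_add_atTop {N : ℕ} (hN : 0 < N) (i : ℕ) :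
    Tendsto (fun k => k * N + i) atTop atTop :=
  tendsto_atTop_mono (fun k => (Nat.le_mul_of_pos_right k hN).trans (Nat.le_add_right _ _))
    tendsto_id

lemma convBV_of_abs_sub_tendsto {N m : ℕ} (hN : 0 < N) {y s : ℕ → ℝ}
    (hs : Function.Periodic s N) (hlim : Tendsto (fun n => |y n - s n|) atTop (𝓝 0))
    (h : totalVariation N m y < ∞) (K : Set ℝ) (i : ℕ) :
    ConvBV K (fun k _ => y (k * N + i)) (fun _ => s i) := by
  refine ConvBV.of_seq ?_ (summable_variation hN h i)
  have h1 := (tendsto_zero_iff_abs_tendsto_zero _).2 (hlim.comp (tendsto_mul_add_atTop hN i))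
  have h2 := h1.add_const (s i)
  rw [zero_add] at h2
  refine h2.congr fun k => ?_
  simp only [periodic_mul_add hs]
  ring

/-- The ratios `a (n - 1) / a n` equal `r n - (r n * a n - a (n - 1)) / a n`, so they tend to `r`. -/
lemma convBV_ratio {N : ℕ} {a r s : ℕ → ℝ} {K : Set ℝ} {i : ℕ} (ha : ∀ n, 0 < a n)
    (hr : Function.Periodic r N)
    (hinv : ConvBV K (fun k _ => (a (k * N + i))⁻¹) (fun _ => 0))
    (hleft : ConvBV K (fun k _ => r (k * N + i) * a (k * N + i) - a (k * N + i - 1))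
      (fun _ => s i)) :
    ConvBV K (fun k _ => a (k * N + i - 1) / a (k * N + i)) (fun _ => r i) := by
  have h := (ConvBV.const_real (K := K) (r i)).sub (hleft.mul hinv)
  simp only [mul_zero, sub_zero] at h
  convert h using 3 with k x
  have := (ha (k * N + i)).ne'
  rw [periodic_mul_add hr]
  field_simp
  ring

/-- The product of `r` over a period is `det (γ • 1) = γ ^ 2 = 1`. -/
lemma ne_zero_of_orderedProd_eq {N : ℕ} {r q : ℕ → ℝ} {γ : ℝ} (hN : 0 < N)
    (hr : Function.Periodic r N) (hγ : γ ^ 2 = 1)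
    (hprod : orderedProd (stepMatrix r q) 0 N = γ • (1 : Matrix (Fin 2) (Fin 2) ℝ)) (i : ℕ) :
    r i ≠ 0 := by
  have h := det_orderedProd (stepMatrix r q) 0 N
  simp only [hprod, det_stepMatrix, zero_add, Matrix.det_smul, Fintype.card_fin, hγ,
    Matrix.det_one, mul_one] at h
  rw [← hr.map_mod_nat i]
  exact Finset.prod_ne_zero_iff.1 (by rw [← h]; exact one_ne_zero) _
    (Finset.mem_Ico.2 ⟨Nat.zero_le _, Nat.mod_lt i hN⟩)

lemma convBV_id {K : Set ℝ} (hK : IsCompact K) : ConvBV K (fun _ x => x) (fun x => x) := by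
  refine ConvBV.const ?_
  obtain ⟨B, hB⟩ := hK.isBounded.exists_norm_le
  exact ⟨B, hB⟩

namespace IsPeriodicPerturbation

variable {N : ℕ} {a b r q s z : ℕ → ℝ} {K : Set ℝ}

lemma ratio (h : IsPeriodicPerturbation N a b r q s z) (K : Set ℝ) (i : ℕ) :
    ConvBV K (fun k _ => a (k * N + i - 1) / a (k * N + i)) (fun _ => r i) :=
  convBV_ratio h.pos h.r_periodic (h.inv K i) (h.left K i)

lemma diagonal (h : IsPeriodicPerturbation N a b r q s z) (hK : IsCompact K) (i : ℕ) :
    ConvBV K (fun k x => (x - b (k * N + i)) / a (k * N + i)) (fun _ => -q i) := by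
  have h1 := (ConvBV.const_real (K := K) (-q i)).add
    (((convBV_id hK).sub (h.diag K i)).mul (h.inv K i))
  simp only [mul_zero, add_zero] at h1
  convert h1 using 3 with k x
  have := (h.pos (k * N + i)).ne'
  rw [periodic_mul_add h.q_periodic]
  field_simp
  ring

lemma transferMatrix (h : IsPeriodicPerturbation N a b r q s z) (hK : IsCompact K) (i : ℕ) :
    MatConvBV K (fun k x => transferMatrix a b x (k * N + i)) (fun _ => stepMatrix r q i) := by
  intro i' j'
  fin_cases i' <;> fin_cases j'
  · exact ConvBV.const_real 0
  · exact ConvBV.const_real 1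
  · exact (h.ratio K i).neg
  · exact h.diagonal hK i

lemma perturbation (h : IsPeriodicPerturbation N a b r q s z) (hK : IsCompact K) (i : ℕ) :
    MatConvBV K (fun k x => perturbation a b r q x (k * N + i))
      (fun x => !![0, 0; s i, x - z i]) := by
  intro i' j'
  fin_cases i' <;> fin_cases j'
  · exact ConvBV.const_real 0
  · exact ConvBV.const_real 0
  · exact h.left K i
  · exact (convBV_id hK).sub (h.diag K i)

/-- The quotient is the inverse of the telescoping product of the ratios `a (n - 1) / a n` over
`k N + j < n < (k + 1) N`. -/
lemma weight_inv (h : IsPeriodicPerturbation N a b r q s z) (K : Set ℝ) {j : ℕ} (hj : j < N) :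
    ConvBV K (fun k _ => a (k * N + (N - 1)) / a (k * N + j)) (fun _ => (weight N r j)⁻¹) := by
  have htel : ∀ k m, j + 1 ≤ m → ∏ i ∈ Finset.Ico (j + 1) m, a (k * N + i - 1) / a (k * N + i)
      = a (k * N + j) / a (k * N + m - 1) := by
    intro k m hm
    induction m, hm using Nat.le_induction with
    | base =>
      rw [Finset.Ico_self, Finset.prod_empty, ← add_assoc, Nat.add_sub_cancel,
        div_self (h.pos _).ne']
    | succ m hm ih =>
      rw [Finset.prod_Ico_succ_top hm, ih, ← add_assoc, Nat.add_sub_cancel,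
        div_mul_div_cancel₀ (h.pos _).ne']
  have h1 := (ConvBV.prod (Finset.Ico (j + 1) N) fun i _ => h.ratio K i).inv
    (fun k => Finset.prod_pos fun i _ => div_pos (h.pos _) (h.pos _))
    (Finset.prod_pos fun i _ => h.r_pos i)
  convert h1 using 3 with k x
  · rw [htel k N hj, inv_div, show k * N + (N - 1) = k * N + N - 1 by omega]
  · rfl

/-- The block remainders converge to `limitMatrix`, with variation summable uniformly on compact
sets of spectral parameters. -/
lemma blockRemainder (h : IsPeriodicPerturbation N a b r q s z) (hK : IsCompact K) :
    MatConvBV K (blockRemainder N a b r q) (limitMatrix N r q s z) := by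
  refine MatConvBV.sum _ fun j hj => ?_
  exact MatConvBV.smul (h.weight_inv K (Finset.mem_range.1 hj))
    (((MatConvBV.orderedProd (h.transferMatrix hK) _ _).mul (h.perturbation hK j)).mul
      (MatConvBV.const _))

end IsPeriodicPerturbation

/-! ### Uniform comparison of solutions -/

lemma MatConvBV.exists_bound {X : Type*} {K : Set X} {F : ℕ → X → Matrix (Fin 2) (Fin 2) ℝ}
    {L : X → Matrix (Fin 2) (Fin 2) ℝ} (h : MatConvBV K F L) :
    ∃ B, 0 ≤ B ∧ ∀ k, ∀ x ∈ K, ∀ i j, |F k x i j| ≤ B := by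
  choose B hB0 hB using fun i j => (h i j).bounded
  refine ⟨∑ i, ∑ j, B i j, Finset.sum_nonneg fun i _ => Finset.sum_nonneg fun j _ => hB0 i j,
    fun k x hx i j => (hB i j k x hx).trans ?_⟩
  exact (Finset.single_le_sum (f := B i) (fun j _ => hB0 i j) (Finset.mem_univ j)).trans
    (Finset.single_le_sum (f := fun i => ∑ j, B i j)
      (fun i _ => Finset.sum_nonneg fun j _ => hB0 i j) (Finset.mem_univ i))

lemma MatConvBV.exists_variation {X : Type*} {K : Set X}
    {F : ℕ → X → Matrix (Fin 2) (Fin 2) ℝ} {L : X → Matrix (Fin 2) (Fin 2) ℝ}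
    (h : MatConvBV K F L) :
    ∃ ε : ℕ → ℝ, Summable ε ∧ (∀ k, 0 ≤ ε k) ∧
      ∀ k, ∀ x ∈ K, ∀ i j, |(F (k + 1) x - F k x) i j| ≤ ε k := by
  choose ε hε hvar using fun i j => (h i j).variation
  refine ⟨fun k => ∑ i, ∑ j, |ε i j k|, summable_sum fun i _ => summable_sum fun j _ => (hε i j).abs,
    fun k => Finset.sum_nonneg fun i _ => Finset.sum_nonneg fun j _ => abs_nonneg _,
    fun k x hx i j => ((hvar i j k x hx).trans (le_abs_self _)).trans ?_⟩
  exact (Finset.single_le_sum (f := fun j => |ε i j k|) (fun j _ => abs_nonneg _)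
    (Finset.mem_univ j)).trans (Finset.single_le_sum (f := fun i => ∑ j, |ε i j k|)
      (fun i _ => Finset.sum_nonneg fun j _ => abs_nonneg _) (Finset.mem_univ i))

lemma exists_disc_le (N : ℕ) (r q s z : ℕ → ℝ) {K : Set ℝ} (hK : IsCompact K)
    (hsub : K ⊆ (exceptionalSet N r q s z)ᶜ) :
    ∃ d, 0 < d ∧ ∀ x ∈ K,
      (limitMatrix N r q s z x).trace ^ 2 - 4 * (limitMatrix N r q s z x).det ≤ -d := by
  rcases K.eq_empty_or_nonempty with rfl | hne
  · exact ⟨1, one_pos, by simp⟩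
  have hcont : Continuous fun x =>
      (limitMatrix N r q s z x).trace ^ 2 - 4 * (limitMatrix N r q s z x).det := by
    have hentry : ∀ i j, Continuous fun x => limitMatrix N r q s z x i j := by
      intro i j
      have e : (fun x => limitMatrix N r q s z x i j)
          = fun x => limitMatrix N r q s z 0 i j + x * limitSlope N r q i j :=
        funext fun x => by
          rw [limitMatrix_eq, Matrix.add_apply, Matrix.smul_apply, smul_eq_mul]
      rw [e]
      fun_prop
    simp only [Matrix.trace_fin_two, Matrix.det_fin_two]
    fun_prop
  obtain ⟨x₀, hx₀, hmax⟩ := hK.exists_isMaxOn hne hcont.continuousOn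
  refine ⟨-((limitMatrix N r q s z x₀).trace ^ 2 - 4 * (limitMatrix N r q s z x₀).det),
    neg_pos.2 (not_le.1 (hsub hx₀)), fun x hx => ?_⟩
  rw [neg_neg]
  exact hmax hx

section Solutions

variable {N : ℕ} {a b r q s z : ℕ → ℝ} {K : Set ℝ}

/-- Uniform comparability of the weighted squared norms of `(u_{n-1}, u_n)` along the multiples of
`N`. -/
lemma exists_comparable_block {γ : ℝ} (h : IsPeriodicPerturbation N a b r q s z) (hN : 0 < N)
    (hprod : orderedProd (stepMatrix r q) 0 N = γ • (1 : Matrix (Fin 2) (Fin 2) ℝ))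
    (hK : IsCompact K) (hsub : K ⊆ (exceptionalSet N r q s z)ᶜ) :
    ∃ (E : ℝ) (k₀ : ℕ), 1 ≤ E ∧ ∀ x ∈ K, ∀ u, IsGeneralizedEigenvector a b x u → ∀ k, k₀ ≤ k →
      Comparable E
        (a ((k + 1) * N - 1) * (u ((k + 1) * N - 1) ^ 2 + u ((k + 1) * N) ^ 2))
        (a ((k₀ + 1) * N - 1) * (u ((k₀ + 1) * N - 1) ^ 2 + u ((k₀ + 1) * N) ^ 2)) := by
  have hR := h.blockRemainder hK
  obtain ⟨B, hB0, hB⟩ := hR.exists_bound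
  obtain ⟨ε, hε, hε0, hvar⟩ := hR.exists_variation
  obtain ⟨d, hd, hdisc⟩ := exists_disc_le N r q s z hK hsub
  obtain ⟨k₁, hk₁⟩ := hR.disc.uniform (half_pos hd)
  -- `c` bounds the ratio of `v 0 ^ 2 + v 1 ^ 2` and the absolute value of the form at `v`.
  obtain ⟨c, hc, hc1, hc2⟩ : ∃ c, 1 ≤ c ∧ 2 * B ≤ c ∧ 8 * B / (d / 2) ≤ c :=
    ⟨max 1 (max (2 * B) (8 * B / (d / 2))), le_max_left _ _,
      (le_max_left _ _).trans (le_max_right _ _), (le_max_right _ _).trans (le_max_right _ _)⟩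
  have hc0 : 0 ≤ c := by linarith
  have hη : Summable fun k => 2 * c * ε (k + 1) :=
    ((summable_nat_add_iff 1).2 hε).mul_left (2 * c)
  obtain ⟨k₂, hk₂⟩ := eventually_atTop.1
    (hη.tendsto_atTop_zero.eventually_le_const (by norm_num : (0 : ℝ) < 1 / 2))
  refine ⟨c * Real.exp (2 * ∑' k, 2 * c * ε (k + 1)) * c, max k₁ k₂, ?_, ?_⟩
  · refine one_le_mul_of_one_le_of_one_le (one_le_mul_of_one_le_of_one_le hc ?_) hc
    exact Real.one_le_exp (mul_nonneg zero_le_two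
      (tsum_nonneg fun k => mul_nonneg (by linarith) (hε0 _)))
  intro x hx u hu
  set t : ℕ → ℝ := fun k => |a (k * N + (N - 1))
    * turanForm (Jacobi.blockRemainder N a b r q (k + 1) x) (state u ((k + 1) * N))| with ht
  set y : ℕ → ℝ := fun n => a (n - 1) * (u (n - 1) ^ 2 + u n ^ 2) with hy
  have hidx : ∀ k, (k + 1) * N - 1 = k * N + (N - 1) := by
    intro k
    rw [add_mul, one_mul]
    omega
  have hyk : ∀ k, y ((k + 1) * N) = a (k * N + (N - 1))
      * (state u ((k + 1) * N) 0 ^ 2 + state u ((k + 1) * N) 1 ^ 2) := by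
    intro k
    simp only [hy, state, Matrix.cons_val_zero, Matrix.cons_val_one, hidx]
  have hyt : ∀ k, max k₁ k₂ ≤ k → Comparable c (y ((k + 1) * N)) (t k) := by
    intro k hk
    have hk' : k₁ ≤ k + 1 := ((le_max_left _ _).trans hk).trans (Nat.le_succ k)
    have h1 : (Jacobi.blockRemainder N a b r q (k + 1) x).trace ^ 2
        - 4 * (Jacobi.blockRemainder N a b r q (k + 1) x).det ≤ -(d / 2) := by
      linarith [(abs_lt.1 (hk₁ (k + 1) hk' x hx)).2, hdisc x hx]
    have h2 := le_abs_turanForm (hB (k + 1) x hx) h1 (state u ((k + 1) * N))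
    have h3 := abs_turanForm_le (hB (k + 1) x hx) (state u ((k + 1) * N))
    have ha := h.pos (k * N + (N - 1))
    simp only [ht]
    rw [hyk, abs_mul, abs_of_pos ha]
    constructor
    · rw [mul_left_comm]
      refine mul_le_mul_of_nonneg_left (le_trans ?_ (mul_le_mul_of_nonneg_right hc2
        (abs_nonneg _))) ha.le
      rw [div_mul_eq_mul_div, le_div_iff₀ (half_pos hd)]
      linarith
    · rw [mul_left_comm]
      exact mul_le_mul_of_nonneg_left (h3.trans (mul_le_mul_of_nonneg_right hc1
        (by positivity))) ha.le
  have hstep : ∀ k, max k₁ k₂ ≤ k → |t (k + 1) - t k| ≤ 2 * c * ε (k + 1) * t (k + 1) := by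
    intro k hk
    have h1 := (hyt (k + 1) (by omega)).1
    have h2 := abs_turanForm_le (hvar (k + 1) x hx) (state u ((k + 1 + 1) * N))
    have ha := h.pos ((k + 1) * N + (N - 1))
    refine (abs_abs_sub_abs_le_abs_sub _ _).trans ?_
    rw [← turan_step hN h.pos h.r_periodic h.q_periodic hprod hu k, ← mul_sub, ← turanForm_sub,
      abs_mul, abs_of_pos ha]
    calc _ ≤ a ((k + 1) * N + (N - 1)) * _ := mul_le_mul_of_nonneg_left h2 ha.le
      _ = 2 * ε (k + 1) * y ((k + 1 + 1) * N) := by rw [hyk]; ring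
      _ ≤ 2 * ε (k + 1) * (c * t (k + 1)) :=
          mul_le_mul_of_nonneg_left h1 (mul_nonneg zero_le_two (hε0 _))
      _ = _ := by ring
  intro k hk
  have h1 := comparable_of_summable_increments (t := t) hη
    (fun k => mul_nonneg (by linarith) (hε0 _))
    (fun k hk => hk₂ k ((le_max_right k₁ k₂).trans hk)) (fun k => abs_nonneg _) hstep hk
  exact ((hyt k hk).trans h1 hc0 (Real.exp_pos _).le).trans (hyt _ le_rfl).symm
    (mul_nonneg hc0 (Real.exp_pos _).le) hc0

/-- Uniform bounds on the coefficients of the transfer matrices and of their inverses. -/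
lemma IsPeriodicPerturbation.exists_coeff_bound (h : IsPeriodicPerturbation N a b r q s z)
    (hN : 0 < N) (hK : IsCompact K) :
    ∃ B, 1 ≤ B ∧ (∀ n, a (n - 1) ≤ B * a n) ∧ (∀ n, a n ≤ B * a (n - 1)) ∧
      ∀ n, ∀ x ∈ K, |x - b n| ≤ B * a n := by
  obtain ⟨B₁, hB₁⟩ := exists_bound_of_residues hN (K := (Set.univ : Set ℝ))
    (f := fun n _ => a (n - 1) / a n) fun j => (h.ratio Set.univ j).bounded
  obtain ⟨B₂, hB₂⟩ := exists_bound_of_residues hN (K := (Set.univ : Set ℝ))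
    (f := fun n _ => (a (n - 1) / a n)⁻¹) fun j => ((h.ratio Set.univ j).inv
      (fun k => div_pos (h.pos _) (h.pos _)) (h.r_pos j)).bounded
  obtain ⟨B₃, hB₃⟩ := exists_bound_of_residues hN
    (f := fun n x => (x - b n) / a n) fun j => (h.diagonal hK j).bounded
  refine ⟨max 1 (max B₁ (max B₂ B₃)), le_max_left _ _, fun n => ?_, fun n => ?_,
    fun n x hx => ?_⟩
  · rw [← div_le_iff₀ (h.pos n)]
    exact ((le_abs_self _).trans (hB₁ n 0 trivial)).trans (by simp)
  · rw [← div_le_iff₀ (h.pos _), ← inv_div]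
    exact ((le_abs_self _).trans (hB₂ n 0 trivial)).trans (by simp)
  · have := hB₃ n x hx
    rw [abs_div, abs_of_pos (h.pos n), div_le_iff₀ (h.pos n)] at this
    exact this.trans (mul_le_mul_of_nonneg_right (by simp) (h.pos n).le)

lemma sq_add_sq_le_of_abs_le {C p v w : ℝ} (hC : 1 ≤ C) (h : |p| ≤ C * (|v| + |w|)) :
    p ^ 2 + v ^ 2 ≤ 3 * C ^ 2 * (v ^ 2 + w ^ 2) := by
  have h1 : p ^ 2 ≤ (C * (|v| + |w|)) ^ 2 := by
    rw [← sq_abs]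
    exact pow_le_pow_left₀ (abs_nonneg _) h 2
  have h2 : (|v| + |w|) ^ 2 ≤ 2 * (v ^ 2 + w ^ 2) := by
    rw [← sq_abs v, ← sq_abs w]
    linarith [sq_nonneg (|v| - |w|)]
  have h3 : v ^ 2 + w ^ 2 ≤ C ^ 2 * (v ^ 2 + w ^ 2) :=
    le_mul_of_one_le_left (by positivity) (one_le_pow₀ hC)
  rw [mul_pow] at h1
  linarith [mul_le_mul_of_nonneg_left h2 (sq_nonneg C), sq_nonneg w]

lemma comparable_succ {B x : ℝ} {u : ℕ → ℝ} (ha : ∀ n, 0 < a n) (hB : 1 ≤ B)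
    (h1 : ∀ n, a (n - 1) ≤ B * a n) (h2 : ∀ n, a n ≤ B * a (n - 1))
    (h3 : ∀ n, |x - b n| ≤ B * a n) (hu : IsGeneralizedEigenvector a b x u) {n : ℕ}
    (hn : 1 ≤ n) :
    Comparable (3 * B ^ 5) (a (n + 1 - 1) * (u (n + 1 - 1) ^ 2 + u (n + 1) ^ 2))
      (a (n - 1) * (u (n - 1) ^ 2 + u n ^ 2)) := by
  have hB0 : 0 ≤ B := by linarith
  rw [Nat.add_sub_cancel]
  have hα := ha (n - 1)
  have hβ := ha n
  have hrec : a n * u (n + 1) = (x - b n) * u n - a (n - 1) * u (n - 1) := by linarith [hu n hn]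
  have e1 := h1 n
  have e2 := h2 n
  have e3 := h3 n
  generalize a (n - 1) = α at *
  generalize a n = β at *
  generalize u (n - 1) = p at *
  generalize u n = v at *
  generalize u (n + 1) = w at *
  generalize x - b n = τ at *
  have hτ : |τ| * |v| ≤ B * β * |v| := mul_le_mul_of_nonneg_right e3 (abs_nonneg v)
  have hw : |w| ≤ B * (|v| + |p|) := by
    refine le_of_mul_le_mul_left ?_ hβ
    have h4 : β * |w| ≤ |τ| * |v| + α * |p| := by
      rw [← abs_of_pos hβ, ← abs_mul, hrec, ← abs_of_pos hα, ← abs_mul, ← abs_mul, abs_of_pos hα]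
      exact abs_sub _ _
    linarith [mul_le_mul_of_nonneg_right e1 (abs_nonneg p)]
  have hp : |p| ≤ B ^ 2 * (|v| + |w|) := by
    refine le_of_mul_le_mul_left ?_ hα
    have h4 : α * |p| ≤ |τ| * |v| + β * |w| := by
      rw [← abs_of_pos hα, ← abs_mul, show α * p = τ * v - β * w by linarith, ← abs_of_pos hβ,
        ← abs_mul, ← abs_mul, abs_of_pos hβ]
      exact abs_sub _ _
    have h5 : β * |w| ≤ B * β * |w| := mul_le_mul_of_nonneg_right
      (le_mul_of_one_le_left hβ.le hB) (abs_nonneg w)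
    have h6 : B * β * (|v| + |w|) ≤ B * (B * α) * (|v| + |w|) := by gcongr
    linarith
  have hB3 : B ^ 3 ≤ B ^ 5 := pow_le_pow_right₀ hB (by norm_num)
  constructor
  · calc β * (v ^ 2 + w ^ 2) = β * (w ^ 2 + v ^ 2) := by ring
      _ ≤ (B * α) * (3 * B ^ 2 * (v ^ 2 + p ^ 2)) := by
          gcongr
          exact sq_add_sq_le_of_abs_le hB hw
      _ = 3 * B ^ 3 * (α * (p ^ 2 + v ^ 2)) := by ring
      _ ≤ 3 * B ^ 5 * (α * (p ^ 2 + v ^ 2)) := by gcongr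
  · calc α * (p ^ 2 + v ^ 2) ≤ (B * β) * (3 * (B ^ 2) ^ 2 * (v ^ 2 + w ^ 2)) := by
          gcongr
          exact sq_add_sq_le_of_abs_le (one_le_pow₀ hB) hp
      _ = 3 * B ^ 5 * (β * (v ^ 2 + w ^ 2)) := by ring

lemma exists_comparable {γ : ℝ} (h : IsPeriodicPerturbation N a b r q s z) (hN : 0 < N)
    (hprod : orderedProd (stepMatrix r q) 0 N = γ • (1 : Matrix (Fin 2) (Fin 2) ℝ))
    (hK : IsCompact K) (hsub : K ⊆ (exceptionalSet N r q s z)ᶜ) :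
    ∃ C, 0 < C ∧ ∀ x ∈ K, ∀ u, IsGeneralizedEigenvector a b x u → ∀ n, 1 ≤ n →
      Comparable C (a n * (u (n - 1) ^ 2 + u n ^ 2)) (u 0 ^ 2 + u 1 ^ 2) := by
  obtain ⟨E, k₀, hE, hblock⟩ := exists_comparable_block h hN hprod hK hsub
  obtain ⟨B, hB, h1, h2, h3⟩ := h.exists_coeff_bound hN hK
  have hB0 : 0 < B := by linarith
  have hc : 1 ≤ 3 * B ^ 5 := by linarith [one_le_pow₀ hB (n := 5)]
  have ha0 := h.pos 0
  refine ⟨B * ((3 * B ^ 5) ^ N * E * (3 * B ^ 5) ^ ((k₀ + 1) * N)) * max (a 0) (a 0)⁻¹,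
    mul_pos (by positivity) (lt_max_of_lt_left ha0), fun x hx u hu n hn => ?_⟩
  have hy := comparable_of_comparable_mul hN hc hE (k₀ := k₀)
    (y := fun n => a (n - 1) * (u (n - 1) ^ 2 + u n ^ 2))
    (fun n => mul_nonneg (h.pos _).le (by positivity))
    (fun n hn => comparable_succ h.pos hB h1 h2 (fun n => h3 n x hx) hu hn)
    (hblock x hx u hu) hn
  have hleft : Comparable B (a n * (u (n - 1) ^ 2 + u n ^ 2))
      (a (n - 1) * (u (n - 1) ^ 2 + u n ^ 2)) := by
    constructor
    · rw [← mul_assoc]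
      exact mul_le_mul_of_nonneg_right (h2 n) (by positivity)
    · rw [← mul_assoc]
      exact mul_le_mul_of_nonneg_right (h1 n) (by positivity)
  have hright : Comparable (max (a 0) (a 0)⁻¹) (a 0 * (u 0 ^ 2 + u 1 ^ 2))
      (u 0 ^ 2 + u 1 ^ 2) := by
    constructor
    · exact mul_le_mul_of_nonneg_right (le_max_left _ _) (by positivity)
    · calc u 0 ^ 2 + u 1 ^ 2 = (a 0)⁻¹ * (a 0 * (u 0 ^ 2 + u 1 ^ 2)) := by
            rw [inv_mul_cancel_left₀ ha0.ne']
        _ ≤ _ := mul_le_mul_of_nonneg_right (le_max_right _ _) (by positivity)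
  exact (hleft.trans hy hB0.le (by positivity)).trans hright (by positivity)
    (ha0.le.trans (le_max_left _ _))

end Solutions

end Jacobi

theorem theoremC (N : ℕ) (hN : 0 < N) (a b r q s z : ℕ → ℝ) (ha : ∀ n, 0 < a n)
    (hr : Function.Periodic r N) (hq : Function.Periodic q N)
    (hs : Function.Periodic s N) (hz : Function.Periodic z N)
    (γ : ℝ) (hγ : γ = -1 ∨ γ = 1)
    (hprod : Jacobi.orderedProd (Jacobi.stepMatrix r q) 0 N
      = γ • (1 : Matrix (Fin 2) (Fin 2) ℝ))
    (hvar : Jacobi.totalVariation N 0 (fun n => 1 / a n)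
      + Jacobi.totalVariation N 1 (fun n => r n * a n - a (n - 1))
      + Jacobi.totalVariation N 0 (fun n => b n - q n * a n) < ∞)
    (hlim_a : Tendsto a atTop atTop)
    (hlim_s : Tendsto (fun n => |r n * a n - a (n - 1) - s n|) atTop (𝓝 0))
    (hlim_z : Tendsto (fun n => |b n - q n * a n - z n|) atTop (𝓝 0)) :
    (∃ x₁ x₂ : ℝ, x₁ ≤ x₂ ∧ Jacobi.exceptionalSet N r q s z = Set.Icc x₁ x₂) ∧
    ∀ K : Set ℝ, IsCompact K → K ⊆ (Jacobi.exceptionalSet N r q s z)ᶜ →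
      ∃ c₁ c₂ : ℝ, 0 < c₁ ∧ 0 < c₂ ∧
        ∀ x ∈ K, ∀ u : ℕ → ℝ, Jacobi.IsGeneralizedEigenvector a b x u →
          ∀ n : ℕ, 1 ≤ n →
            c₁ * (u 0 ^ 2 + u 1 ^ 2) ≤ a n * (u (n - 1) ^ 2 + u n ^ 2) ∧
            a n * (u (n - 1) ^ 2 + u n ^ 2) ≤ c₂ * (u 0 ^ 2 + u 1 ^ 2) := by
  have hγ2 : γ ^ 2 = 1 := by rcases hγ with rfl | rfl <;> norm_num
  have hr0 := Jacobi.ne_zero_of_orderedProd_eq hN hr hγ2 hprod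
  rw [ENNReal.add_lt_top, ENNReal.add_lt_top] at hvar
  obtain ⟨⟨hva, hvs⟩, hvz⟩ := hvar
  have hinv : ∀ (K : Set ℝ) (i : ℕ),
      Jacobi.ConvBV K (fun k _ => (a (k * N + i))⁻¹) (fun _ => 0) := by
    intro K i
    refine Jacobi.ConvBV.of_seq
      (hlim_a.comp (Jacobi.tendsto_mul_add_atTop hN i)).inv_tendsto_atTop ?_
    simpa only [one_div] using Jacobi.summable_variation hN hva i
  have hleft := Jacobi.convBV_of_abs_sub_tendsto hN hs hlim_s hvs
  have hrpos : ∀ i, 0 < r i := fun i => (hr0 i).symm.lt_of_le <|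
    -- `r i` is the limit of the positive ratios `a (n - 1) / a n`.
    ge_of_tendsto' ((Jacobi.convBV_ratio ha hr (hinv Set.univ i)
      (hleft Set.univ i)).tendsto 0 trivial) fun k => (div_pos (ha _) (ha _)).le
  have h : Jacobi.IsPeriodicPerturbation N a b r q s z :=
    { pos := ha
      r_pos := hrpos
      inv := hinv
      left := hleft
      diag := Jacobi.convBV_of_abs_sub_tendsto hN hz hlim_z hvz
      r_periodic := hr
      q_periodic := hq }
  refine ⟨Jacobi.exceptionalSet_eq_Icc s z hN hr0 hγ2 hprod, fun K hK hsub => ?_⟩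
  obtain ⟨C, hC, hcomp⟩ := Jacobi.exists_comparable h hN hprod hK hsub
  refine ⟨C⁻¹, C, inv_pos.2 hC, hC, fun x hx u hu n hn => ⟨?_, (hcomp x hx u hu n hn).1⟩⟩
  rw [inv_mul_le_iff₀ hC]
  exact (hcomp x hx u hu n hn).2
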